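/- Let $\mathcal{L}$ be an algebraic signature (operation symbols only) with at least one constant symbol, and let $\mathcal{V}$ be a variety of $\mathcal{L}$-algebras, i.e. the class of all $\mathcal{L}$-algebras satisfying some set of equations. Below $\overline{x},\overline{y},\overline{z}$ always denote pairwise disjoint sets of variables, and $\Sigma(\overline{x})$ denotes a set of $\mathcal{L}$-equations whose variables are included in $\overline{x}$. For sets of equations $\Sigma(\overline{x}),\Delta(\overline{x})$, write $\Sigma\models_{\mathcal{V}}\Delta$ if for every $\mathbf{A}\in\mathcal{V}$, every assignment $\overline{x}\to A$ that satisfies all equations in $\Sigma$ satisfies all equations in $\Delta$; write $\Gamma,\Sigma$ for $\Gamma\cup\Sigma$. $\mathcal{V}$ admits *left uniform Maehara interpolation* if for any finite sets $\overline{y},\overline{z}$ and finite sets of equations $\Sigma(\overline{y},\overline{z}),\Delta(\overline{y},\overline{z})$, there exists a finite set of equations $\Pi(\overline{y})$ such that for any finite set $\overline{x}$ and finite set of equations $\Gamma(\overline{x},\overline{y})$, $$\Gamma,\Sigma\models_{\mathcal{V}}\Delta\iff\Gamma\models_{\mathcal{V}}\Pi.$$ $\mathcal{V}$ admits *right uniform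 Maehara interpolation* if for any finite sets $\overline{x},\overline{y}$ and finite set of equations $\Gamma(\overline{x},\overline{y})$, there exists a finite set of equations $\Pi(\overline{y})$ such that for any finite set $\overline{z}$ and finite sets of equations $\Sigma(\overline{y},\overline{z}),\Delta(\overline{y},\overline{z})$, $$\Gamma,\Sigma\models_{\mathcal{V}}\Delta\iff\Pi,\Sigma\models_{\mathcal{V}}\Delta.$$ The *theory of $\mathcal{V}$* is the set of all first-order $\mathcal{L}$-sentences true in all algebras of $\mathcal{V}$. A *model completion* of a first-order theory $T$ is a theory $T^*$ in the same language such that 1. $T^*$ is model complete: every formula is equivalent over $T^*$ to an existential formula in the same free variables; 2. $T$ and $T^*$ entail the same universal sentences; 3. for every model $M$ of $T$, the theory $T^*$ together with the diagram of $M$ (the set of all atomic and negated atomic sentences with parameters from $M$ that are true in $M$) is complete, i.e. satisfiable and, for each sentence with parameters from $M$, entailing it or its negation. **Corollary 5.5.** If $\mathcal{V}$ admits both left and right uniform Maehara interpolation, then the theory of $\mathcal{V}$ has a model completion. -/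

import Mathlib

universe u v w

namespace VarietyTheory

open FirstOrder FirstOrder.Language

variable {L : FirstOrder.Language.{u, v}}

/-! ## Equations and equational consequence -/

/-- An equation `s ≈ t` over `L` with variables in `X` is an ordered pair of terms. -/
abbrev Equation (L : FirstOrder.Language.{u, v}) (X : Type w) : Type (max u w) :=
  L.Term X × L.Term X

/-- Regard a set of equations with variables in `X` as one with variables in `Y`, along a map
`g : X → Y` (below, `g` is always an inclusion into a disjoint union of sets of variables). -/
def renameVars {X Y : Type*} (g : X → Y) (S : Set (Equation L X)) : Set (Equation L Y) :=
  (fun e : Equation L X => (e.1.relabel g, e.2.relabel g)) '' S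

/-- The algebra `A` under the assignment `f` satisfies every equation in `S`. -/
def Satisfies {X : Type*} {A : Type*} [L.Structure A] (f : X → A) (S : Set (Equation L X)) :
    Prop :=
  ∀ e ∈ S, e.1.realize f = e.2.realize f

/-- A class of `L`-structures. Its members live in `Type (max u v)`, which has room for every
free algebra over `L` on finitely or countably many generators. -/
abbrev AlgebraClass (L : FirstOrder.Language.{u, v}) : Type (max u v + 1) :=
  Set (CategoryTheory.Bundled.{max u v} L.Structure)

/-- A variety: the class of all algebras that satisfy some set of equations identically. An
equation has finitely many variables, so it can be written with variables from `ℕ`. -/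
def IsVariety (V : AlgebraClass L) : Prop :=
  ∃ E : Set (Equation L ℕ), ∀ A : CategoryTheory.Bundled.{max u v} L.Structure,
    A ∈ V ↔ ∀ f : ℕ → A, Satisfies f E

/-- Equational consequence in the class `V`: every assignment into a member of `V` that satisfies
`S` satisfies `D`. Since members of `V` are non-empty when the language has a constant, variables
in `X` that do not occur in `S` or `D` do not matter. -/
def Entails (V : AlgebraClass L) {X : Type*} (S D : Set (Equation L X)) : Prop :=
  ∀ A ∈ V, ∀ f : X → A, Satisfies f S → Satisfies f D

/-- Right uniform Maehara interpolation. The pairwise disjoint finite sets of variables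
`x̄, ȳ, z̄` are the summands of `X ⊕ (Y ⊕ Z)`. -/
def RightUniformMaehara (V : AlgebraClass L) : Prop :=
  ∀ (X Y : Type) [Finite X] [Finite Y] (G : Set (Equation L (X ⊕ Y))), G.Finite →
    ∃ P : Set (Equation L Y), P.Finite ∧
      ∀ (Z : Type) [Finite Z] (S D : Set (Equation L (Y ⊕ Z))), S.Finite → D.Finite →
        (Entails V
            (renameVars (Sum.map id Sum.inl : X ⊕ Y → X ⊕ (Y ⊕ Z)) G ∪
              renameVars (Sum.inr : Y ⊕ Z → X ⊕ (Y ⊕ Z)) S)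
            (renameVars (Sum.inr : Y ⊕ Z → X ⊕ (Y ⊕ Z)) D) ↔
          Entails V (renameVars (Sum.inl : Y → Y ⊕ Z) P ∪ S) D)

/-- Left uniform Maehara interpolation, with the same conventions on variables. -/
def LeftUniformMaehara (V : AlgebraClass L) : Prop :=
  ∀ (Y Z : Type) [Finite Y] [Finite Z] (S D : Set (Equation L (Y ⊕ Z))), S.Finite → D.Finite →
    ∃ P : Set (Equation L Y), P.Finite ∧
      ∀ (X : Type) [Finite X] (G : Set (Equation L (X ⊕ Y))), G.Finite →
        (Entails V
            (renameVars (Sum.map id Sum.inl : X ⊕ Y → X ⊕ (Y ⊕ Z)) G ∪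
              renameVars (Sum.inr : Y ⊕ Z → X ⊕ (Y ⊕ Z)) S)
            (renameVars (Sum.inr : Y ⊕ Z → X ⊕ (Y ⊕ Z)) D) ↔
          Entails V G (renameVars (Sum.inr : Y → X ⊕ Y) P))

/-- The first-order theory of a class of algebras: all first-order sentences true in every one of
its members. -/
def theoryOf (V : AlgebraClass L) : L.Theory :=
  {φ | ∀ A ∈ V, A ⊨ φ}

/-! ## Model completions -/

/-- Two theories are co-theories if they entail the same universal sentences. -/
def AreCotheories (T T' : L.Theory) : Prop :=
  ∀ φ : L.Sentence, φ.IsUniversal → (T ⊨ᵇ φ ↔ T' ⊨ᵇ φ)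

/-- A theory is model complete if over it every formula is equivalent to an existential formula
in the same free variables. -/
def IsModelComplete (T : L.Theory) : Prop :=
  ∀ (n : ℕ) (φ : L.Formula (Fin n)), ∃ ψ : L.Formula (Fin n), ψ.IsExistential ∧ T.Iff φ ψ

/-- A model companion of `T` is a model complete co-theory of `T`. -/
def IsModelCompanion (T Tstar : L.Theory) : Prop :=
  IsModelComplete Tstar ∧ AreCotheories T Tstar

/-- The diagram of `M`: all atomic and negated atomic sentences, in the language with a new
constant for each element of `M`, that are true in `M`. -/
def diagram (L : FirstOrder.Language.{u, v}) (M : Type w) [L.Structure M] :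
    (L.withConstants M).Theory :=
  {φ | (φ.IsAtomic ∨ ∃ ψ : (L.withConstants M).Sentence, ψ.IsAtomic ∧ φ = ψ.not) ∧ M ⊨ φ}

/-- A model completion of `T` is a model companion `Tstar` of `T` such that, for every model `M`
of `T`, the theory `Tstar` together with the diagram of `M` is complete. -/
def IsModelCompletion (T Tstar : L.Theory) : Prop :=
  IsModelCompanion T Tstar ∧
    ∀ M : FirstOrder.Language.Theory.ModelType.{u, v, max u v} T,
      ((L.lhomWithConstants M).onTheory Tstar ∪ diagram L M).IsComplete

end VarietyTheory

namespace VarietyTheory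

open FirstOrder FirstOrder.Language Structure

variable {L : FirstOrder.Language.{u, v}}

/-! The model completion is the theory of the existentially closed members of `V`. The heart is
`exists_solvableInExtension_iff`: whether a finite system of equations `S`, together with negated
equations `N`, is solvable in an extension of `A` inside `V` depends only on which equations its
parameters satisfy. To test this, adjoin the unknowns to `A` as freely as `S` allows. The right
interpolant of `S` holds at the parameters exactly when `A` still embeds; for `e ∈ N`, the left
interpolant of `S ⊨ e` holds exactly when `e` is forced.

Embeddings preserve and reflect such a criterion, so a solvable system stays solvable over every
larger member of `V`. This takes the place of amalgamation: compactness solves all solvable systems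
over `A` in one extension, and iterating `ω` times yields an existentially closed one. There the
criterion becomes a quantifier-free equivalent of `∃ x`, whence quantifier elimination. This gives
model completeness and, with the embedding into existentially closed algebras, the two remaining
conditions. -/

theorem sumMap_comp_inl {X X' Y Y' : Type*} (f : X → X') (g : Y → Y') :
    Sum.map f g ∘ Sum.inl = Sum.inl ∘ f := rfl

theorem sumMap_comp_inr {X X' Y Y' : Type*} (f : X → X') (g : Y → Y') :
    Sum.map f g ∘ Sum.inr = Sum.inr ∘ g := rfl

/-! ## Satisfaction, renaming and finite supports -/

section Satisfaction

variable {X Y : Type*} {A B : Type*} [L.Structure A] [L.Structure B]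

theorem satisfies_renameVars (g : X → Y) (f : Y → A) (S : Set (Equation L X)) :
    Satisfies f (renameVars g S) ↔ Satisfies (f ∘ g) S := by
  simp only [Satisfies, renameVars, Set.forall_mem_image, Term.realize_relabel]

theorem satisfies_union (f : X → A) (S S' : Set (Equation L X)) :
    Satisfies f (S ∪ S') ↔ Satisfies f S ∧ Satisfies f S' := by
  simp only [Satisfies, Set.mem_union, or_imp, forall_and]

theorem satisfies_singleton (f : X → A) (e : Equation L X) :
    Satisfies f {e} ↔ e.1.realize f = e.2.realize f := by
  simp [Satisfies]

theorem satisfies_empty (f : X → A) : Satisfies f (∅ : Set (Equation L X)) := by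
  simp [Satisfies]

theorem Satisfies.mono {f : X → A} {S S' : Set (Equation L X)} (h : Satisfies f S')
    (hS : S ⊆ S') : Satisfies f S :=
  fun e he => h e (hS he)

theorem realize_eq_embedding_comp (j : A ↪[L] B) (f : X → A) (e : Equation L X) :
    e.1.realize (j ∘ f) = e.2.realize (j ∘ f) ↔ e.1.realize f = e.2.realize f := by
  rw [HomClass.realize_term, HomClass.realize_term, j.injective.eq_iff]

theorem satisfies_embedding_comp (j : A ↪[L] B) (f : X → A) (S : Set (Equation L X)) :
    Satisfies (j ∘ f) S ↔ Satisfies f S :=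
  forall₂_congr fun e _ => realize_eq_embedding_comp j f e

end Satisfaction

theorem renameVars_union {X Y : Type*} (g : X → Y) (S S' : Set (Equation L X)) :
    renameVars g (S ∪ S') = renameVars g S ∪ renameVars g S' :=
  Set.image_union _ _ _

theorem renameVars_renameVars {X Y Z : Type*} (g : X → Y) (h : Y → Z) (S : Set (Equation L X)) :
    renameVars h (renameVars g S) = renameVars (h ∘ g) S := by
  simp [renameVars, Set.image_image]

theorem renameVars_singleton {X Y : Type*} (g : X → Y) (e : Equation L X) :
    renameVars g {e} = {(e.1.relabel g, e.2.relabel g)} :=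
  Set.image_singleton

theorem finite_renameVars {X Y : Type*} (g : X → Y) {S : Set (Equation L X)} (hS : S.Finite) :
    (renameVars g S).Finite :=
  hS.image _

theorem Entails.renameVars {V : AlgebraClass L} {X Y : Type*} {S D : Set (Equation L X)}
    (h : Entails V S D) (g : X → Y) : Entails V (renameVars g S) (renameVars g D) := by
  intro A hA f hf
  rw [satisfies_renameVars] at hf ⊢
  exact h A hA _ hf

/-- Support is phrased by relabelings that fix `F`, since it is only ever applied to a retraction
onto finitely many variables. -/
theorem exists_finite_support_term {X : Type*} (t : L.Term X) :
    ∃ F : Set X, F.Finite ∧ ∀ g : X → X, (∀ x ∈ F, g x = x) → t.relabel g = t := by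
  induction t with
  | var x => exact ⟨{x}, Set.finite_singleton x, fun g hg => by simp [hg x rfl]⟩
  | func f ts ih =>
    choose F hF h using ih
    refine ⟨⋃ i, F i, Set.finite_iUnion hF, fun g hg => ?_⟩
    simp only [Term.relabel, Term.func.injEq, heq_eq_eq, true_and]
    funext i
    exact h i g fun x hx => hg x (Set.mem_iUnion.2 ⟨i, hx⟩)

theorem renameVars_eq_self {X : Type*} {g : X → X} {S : Set (Equation L X)}
    (h : ∀ e ∈ S, (e.1.relabel g, e.2.relabel g) = e) : renameVars g S = S := by
  unfold renameVars
  rw [Set.image_congr h, Set.image_id']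

theorem exists_finite_support {X : Type*} {S : Set (Equation L X)} (hS : S.Finite) :
    ∃ F : Set X, F.Finite ∧ ∀ g : X → X, (∀ x ∈ F, g x = x) →
      ∀ e ∈ S, (e.1.relabel g, e.2.relabel g) = e := by
  choose F hF h using fun t : L.Term X => exists_finite_support_term t
  refine ⟨⋃ e ∈ S, F e.1 ∪ F e.2, hS.biUnion fun e _ => (hF _).union (hF _),
    fun g hg e he => Prod.ext (h _ g fun x hx => hg x ?_) (h _ g fun x hx => hg x ?_)⟩
  · exact Set.mem_biUnion he (Or.inl hx)
  · exact Set.mem_biUnion he (Or.inr hx)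

/-- Interpolation speaks of finite variable sets in `Type`; this replaces variables drawn from the
carrier of an algebra by some `Fin k`. -/
theorem exists_fin_retraction {X : Type*} {F : Set X} (hF : F.Finite) :
    ∃ (k : ℕ) (s : Fin k → X) (r : X → Fin k), ∀ x ∈ F, s (r x) = x := by
  rcases isEmpty_or_nonempty X with hX | ⟨⟨x₀⟩⟩
  · exact ⟨0, Fin.elim0, hX.elim, fun x => hX.elim x⟩
  · have := (hF.insert x₀).to_subtype
    obtain ⟨k, ⟨e⟩⟩ := Finite.exists_equiv_fin (insert x₀ F : Set X)
    classical
    refine ⟨k, fun i => (e.symm i : X),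
      fun x => if h : x ∈ (insert x₀ F : Set X) then e ⟨x, h⟩ else e ⟨x₀, Set.mem_insert _ _⟩,
      fun x hx => ?_⟩
    simp [hx]

/-- A finite set of equations over `Y ⊕ X` involves only finitely many variables from `X`. -/
theorem exists_fin_retraction_renameVars {X Y : Type*} {S : Set (Equation L (Y ⊕ X))}
    (hS : S.Finite) : ∃ (k : ℕ) (s : Fin k → X) (r : X → Fin k),
      ∀ S' ⊆ S, renameVars (Sum.map id (s ∘ r)) S' = S' := by
  obtain ⟨F, hF, h⟩ := exists_finite_support hS
  obtain ⟨k, s, r, hsr⟩ := exists_fin_retraction (hF.preimage Sum.inr_injective.injOn)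
  refine ⟨k, s, r, fun S' hS' => renameVars_eq_self fun e he => h _ ?_ e (hS' he)⟩
  rintro (y | x) hx
  · rfl
  · simp [hsr x hx]

/-- The interpolation equivalence of a right uniform interpolant extends to arbitrary, possibly
infinite, sets of variables. -/
theorem RightUniformMaehara.exists_interpolant {V : AlgebraClass L} (h : RightUniformMaehara V)
    (X Y : Type) [Finite X] [Finite Y] {G : Set (Equation L (X ⊕ Y))} (hG : G.Finite) :
    ∃ P : Set (Equation L Y), P.Finite ∧
      ∀ (Z : Type w) (S D : Set (Equation L (Y ⊕ Z))), S.Finite → D.Finite →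
        (Entails V
            (renameVars (Sum.map id Sum.inl : X ⊕ Y → X ⊕ (Y ⊕ Z)) G ∪
              renameVars (Sum.inr : Y ⊕ Z → X ⊕ (Y ⊕ Z)) S)
            (renameVars (Sum.inr : Y ⊕ Z → X ⊕ (Y ⊕ Z)) D) ↔
          Entails V (renameVars (Sum.inl : Y → Y ⊕ Z) P ∪ S) D) := by
  obtain ⟨P, hP, hPi⟩ := h X Y G hG
  refine ⟨P, hP, fun Z S D hS hD => ?_⟩
  obtain ⟨k, s, r, hsr⟩ := exists_fin_retraction_renameVars (hS.union hD)
  have hS' := hsr S Set.subset_union_left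
  have hD' := hsr D Set.subset_union_right
  -- Entailment survives renaming: go to `Fin k` along `r`, interpolate there, and return along `s`,
  -- as `s ∘ r` fixes `S` and `D`.
  have key := hPi (Fin k) _ _ (finite_renameVars (Sum.map id r) hS)
    (finite_renameVars (Sum.map id r) hD)
  constructor
  · intro hE
    have h1 := hE.renameVars (Sum.map id (Sum.map id r))
    simp only [renameVars_union, renameVars_renameVars, Sum.map_comp_map, sumMap_comp_inl,
      sumMap_comp_inr, Function.comp_id] at h1 key
    have h2 := (key.1 h1).renameVars (Sum.map id s)
    simpa only [renameVars_union, renameVars_renameVars, Sum.map_comp_map, sumMap_comp_inl,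
      Function.id_comp, Function.comp_id, hS', hD'] using h2
  · intro hE
    have h1 := hE.renameVars (Sum.map id r)
    simp only [renameVars_union, renameVars_renameVars, sumMap_comp_inl,
      Function.comp_id] at h1 key
    have h2 := (key.2 h1).renameVars (Sum.map id (Sum.map id s))
    rw [← hS', ← hD']
    simp only [renameVars_union, renameVars_renameVars] at h2 ⊢
    convert h2 using 3 <;> congr 1 <;> funext x <;> rcases x with (x | x) <;> simp

/-- The interpolation equivalence of a left uniform interpolant extends to arbitrary, possibly
infinite, sets of variables. -/
theorem LeftUniformMaehara.exists_interpolant {V : AlgebraClass L} (h : LeftUniformMaehara V)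
    (Y Z : Type) [Finite Y] [Finite Z] {S D : Set (Equation L (Y ⊕ Z))} (hS : S.Finite)
    (hD : D.Finite) :
    ∃ P : Set (Equation L Y), P.Finite ∧
      ∀ (X : Type w) (G : Set (Equation L (X ⊕ Y))), G.Finite →
        (Entails V
            (renameVars (Sum.map id Sum.inl : X ⊕ Y → X ⊕ (Y ⊕ Z)) G ∪
              renameVars (Sum.inr : Y ⊕ Z → X ⊕ (Y ⊕ Z)) S)
            (renameVars (Sum.inr : Y ⊕ Z → X ⊕ (Y ⊕ Z)) D) ↔
          Entails V G (renameVars (Sum.inr : Y → X ⊕ Y) P)) := by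
  obtain ⟨P, hP, hPi⟩ := h Y Z S D hS hD
  refine ⟨P, hP, fun X G hG => ?_⟩
  -- The retraction acts on the right summand, whereas the variables to be reduced here form the
  -- left one.
  obtain ⟨k, s, r, hsr⟩ := exists_fin_retraction_renameVars (finite_renameVars Sum.swap hG)
  have hG' : renameVars (Sum.map (s ∘ r) id) G = G := by
    have := congrArg (renameVars Sum.swap) (hsr _ subset_rfl)
    simp only [renameVars_renameVars] at this
    convert this using 2 <;> try (funext x; rcases x with (x | x) <;> rfl)
    refine (renameVars_eq_self fun e _ => ?_).symm
    simp [Term.relabel_id]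
  have key := hPi (Fin k) _ (finite_renameVars (Sum.map r id) hG)
  constructor
  · intro hE
    have h1 := hE.renameVars (Sum.map r id)
    simp only [renameVars_union, renameVars_renameVars, Sum.map_comp_map,
      sumMap_comp_inr, Function.id_comp, Function.comp_id] at h1 key
    have h2 := (key.1 h1).renameVars (Sum.map s id)
    rw [← hG']
    simpa only [renameVars_renameVars, Sum.map_comp_map, sumMap_comp_inr, Function.id_comp,
      Function.comp_id] using h2
  · intro hE
    have h1 := hE.renameVars (Sum.map r id)
    simp only [renameVars_renameVars, Sum.map_comp_map,
      sumMap_comp_inr, Function.id_comp, Function.comp_id] at h1 key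
    have h2 := (key.2 h1).renameVars (Sum.map s id)
    rw [← hG']
    simp only [renameVars_union, renameVars_renameVars] at h2 ⊢
    convert h2 using 3 <;> congr 1 <;> funext x <;> rcases x with (x | x) <;> simp

/-! ## Presentations by generators and relations -/

/-- Provability from a finite subset of `S`, as an equivalence relation on terms. -/
def presentationSetoid (V : AlgebraClass L) {X : Type w} (S : Set (Equation L X)) :
    Setoid (L.Term X) where
  r s t := ∃ S₀ ⊆ S, S₀.Finite ∧ Entails V S₀ {(s, t)}
  iseqv := by
    refine ⟨fun t => ⟨∅, Set.empty_subset _, Set.finite_empty, ?_⟩, ?_, ?_⟩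
    · intro A _ f _
      simp [satisfies_singleton]
    · rintro s t ⟨S₀, hS, hf, h⟩
      refine ⟨S₀, hS, hf, fun A hA f h0 => ?_⟩
      have := h A hA f h0
      rw [satisfies_singleton] at this ⊢
      exact this.symm
    · rintro s t r ⟨S₀, hS, hf, h⟩ ⟨S₁, hS', hf', h'⟩
      refine ⟨S₀ ∪ S₁, Set.union_subset hS hS', hf.union hf', fun A hA f h0 => ?_⟩
      rw [satisfies_union] at h0
      have e := h A hA f h0.1
      have e' := h' A hA f h0.2
      rw [satisfies_singleton] at e e' ⊢
      exact e.trans e'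

/-- The term algebra. -/
abbrev termStructure (L : FirstOrder.Language.{u, v}) [L.IsAlgebraic] (X : Type w) :
    L.Structure (L.Term X) where
  funMap f ts := Term.func f ts
  RelMap r _ := isEmptyElim r

theorem realize_termStructure [L.IsAlgebraic] {X : Type w} {Y : Type*} (t : L.Term Y)
    (g : Y → L.Term X) : @Term.realize L _ (termStructure L X) _ g t = t.subst g := by
  induction t with
  | var => rfl
  | func f ts ih =>
    change Term.func f _ = Term.func f _
    congr 1
    funext i
    exact ih i

/-- The term algebra modulo provability from `S`. -/
abbrev presentationPrestructure [L.IsAlgebraic] (V : AlgebraClass L) {X : Type w}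
    (S : Set (Equation L X)) : L.Prestructure (presentationSetoid V S) where
  toStructure := termStructure L X
  fun_equiv := by
    intro n f x y hxy
    choose S₀ hS hf h using hxy
    refine ⟨⋃ i, S₀ i, Set.iUnion_subset hS, Set.finite_iUnion hf, fun A hA g hg => ?_⟩
    rw [satisfies_singleton]
    change funMap f _ = funMap f _
    congr 1
    funext i
    exact (satisfies_singleton _ _).1 (h i A hA g (hg.mono (Set.subset_iUnion _ i)))
  rel_equiv := fun {_ r} => isEmptyElim r

/-- Every set of relations presents an algebra of the variety, and an equation between generators
holds in it only if it follows from finitely many of the relations. -/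
theorem IsVariety.exists_presentation [L.IsAlgebraic] {V : AlgebraClass L} (hV : IsVariety V)
    {X : Type (max u v)} (S : Set (Equation L X)) :
    ∃ A ∈ V, ∃ q : X → A, Satisfies q S ∧ ∀ e : Equation L X,
      e.1.realize q = e.2.realize q → ∃ S₀ ⊆ S, S₀.Finite ∧ Entails V S₀ {e} := by
  let st := presentationSetoid V S
  let ps : L.Prestructure st := presentationPrestructure V S
  let A : CategoryTheory.Bundled.{max u v} L.Structure := ⟨Quotient st, inferInstance⟩
  have hreal : ∀ {Y : Type (max u v)} (t : L.Term Y) (g : Y → L.Term X),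
      t.realize (fun y => (⟦g y⟧ : Quotient st)) = ⟦t.subst g⟧ := fun t g => by
    rw [Term.realize_quotient_mk', realize_termStructure]
  have hself : ∀ t : L.Term X, t.subst Term.var = t := fun t => by
    induction t with
    | var => rfl
    | func f ts ih => simp [Term.subst, ih]
  refine ⟨A, ?_, fun x => ⟦Term.var x⟧, fun e he => ?_, fun e he => ?_⟩
  · obtain ⟨E, hE⟩ := hV
    refine (hE A).2 fun f e he => ?_
    choose g hg using fun n => Quotient.exists_rep (f n)
    obtain rfl : (fun n => (⟦g n⟧ : Quotient st)) = f := funext hg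
    change e.1.realize (fun x => (⟦g x⟧ : Quotient st)) = e.2.realize (fun x => ⟦g x⟧)
    rw [Term.realize_quotient_mk', Term.realize_quotient_mk', realize_termStructure,
      realize_termStructure]
    -- A term instance of an identity of `V` is provable from no relations at all.
    refine Quotient.sound ⟨∅, Set.empty_subset _, Set.finite_empty, fun B hB h _ => ?_⟩
    rw [satisfies_singleton, Term.realize_subst, Term.realize_subst]
    exact (hE B).1 hB _ e he
  · change e.1.realize (fun x => (⟦Term.var x⟧ : Quotient st)) = e.2.realize _
    rw [hreal, hreal, hself, hself]
    exact Quotient.sound ⟨{e}, by simpa using he, Set.finite_singleton _, fun A _ f h => h⟩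
  · change e.1.realize (fun x => (⟦Term.var x⟧ : Quotient st)) = e.2.realize _ at he
    rw [hreal, hreal, hself, hself] at he
    exact Quotient.exact he

/-! ## Systems of equations and negated equations -/

/-- The assignment `f` satisfies all the equations in `S` and none of those in `N`. -/
def Solves {X : Type*} {A : Type*} [L.Structure A] (f : X → A) (S N : Set (Equation L X)) : Prop :=
  Satisfies f S ∧ ∀ e ∈ N, e.1.realize f ≠ e.2.realize f

theorem solves_embedding_comp {X A B : Type*} [L.Structure A] [L.Structure B] (j : A ↪[L] B)
    (f : X → A) (S N : Set (Equation L X)) : Solves (j ∘ f) S N ↔ Solves f S N :=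
  and_congr (satisfies_embedding_comp j f S)
    (forall₂_congr fun e _ => not_congr (realize_eq_embedding_comp j f e))

/-- Some extension of `A` in the class `V` solves the system `S, N` with parameters `a`. -/
def SolvableInExtension (V : AlgebraClass L) {Y Z : Type} (S N : Set (Equation L (Y ⊕ Z)))
    (A : CategoryTheory.Bundled.{max u v} L.Structure) (a : Y → A) : Prop :=
  ∃ B ∈ V, ∃ j : A ↪[L] B, ∃ b : Z → B, Solves (Sum.elim (j ∘ a) b) S N

/-- All equations with variables in `Y ⊕ A` true in `A` with the variables from `Y` interpreted
by `a`. -/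
def positiveDiagram {Y : Type*} {A : Type*} [L.Structure A] (a : Y → A) :
    Set (Equation L (Y ⊕ A)) :=
  {e | e.1.realize (Sum.elim a id) = e.2.realize (Sum.elim a id)}

/-- An assignment satisfying the positive diagram of `A`, and separating points, is an embedding
of `A`. -/
theorem exists_embedding_of_satisfies_positiveDiagram [L.IsAlgebraic] {Y A B : Type*}
    [L.Structure A] [L.Structure B] (a : Y → A) (q : Y ⊕ A → B)
    (hq : Satisfies q (positiveDiagram (L := L) a))
    (hinj : Function.Injective (q ∘ Sum.inr)) :
    ∃ j : A ↪[L] B, q = Sum.elim (j ∘ a) j := by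
  let h : A →[L] B :=
    { toFun := q ∘ Sum.inr
      map_fun' := fun {n} f x => by
        have := hq (Term.var (Sum.inr (funMap f x)), Term.func f fun i => Term.var (Sum.inr (x i)))
          (by simp [positiveDiagram])
        simpa [Function.comp_def] using this
      map_rel' := fun {n} r => isEmptyElim r }
  refine ⟨Embedding.ofInjective (f := h) hinj, ?_⟩
  funext x
  rcases x with y | x
  · exact hq (Term.var (Sum.inl y), Term.var (Sum.inr (a y))) (by simp [positiveDiagram])
  · rfl

/-- `P` is the right interpolant of `S` with the unknowns `Z` eliminated, and `Q e` the left
interpolant of `S ⊨ e`. One algebra, the freest one, avoids all of `N` at once, so each negated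
equation can be treated separately. -/
theorem exists_solvableInExtension_iff [L.IsAlgebraic] {V : AlgebraClass L}
    (hV : IsVariety V) (hleft : LeftUniformMaehara V) (hright : RightUniformMaehara V)
    {Y Z : Type} [Finite Y] [Finite Z] {S : Set (Equation L (Y ⊕ Z))} (hS : S.Finite) :
    ∃ (P : Set (Equation L Y)) (Q : Equation L (Y ⊕ Z) → Set (Equation L Y)),
      P.Finite ∧ (∀ e, (Q e).Finite) ∧
      ∀ A ∈ V, ∀ (N : Set (Equation L (Y ⊕ Z))) (a : Y → A), SolvableInExtension V S N A a ↔
        Satisfies a P ∧ ∀ e ∈ N, ¬ Satisfies a (Q e) := by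
  obtain ⟨P, hP, hPi⟩ := RightUniformMaehara.exists_interpolant.{u, v, max u v} hright Z Y
    (finite_renameVars Sum.swap hS)
  choose Q hQ hQi using fun e : Equation L (Y ⊕ Z) =>
    LeftUniformMaehara.exists_interpolant.{u, v, max u v} hleft Y Z hS (Set.finite_singleton e)
  refine ⟨P, Q, hP, hQ, fun A hA N a => ⟨?_, ?_⟩⟩
  · rintro ⟨B, hB, j, b, hbS, hbN⟩
    -- Since `P` entails itself, interpolation shows that `S` entails `P`; likewise `Q e` and `S`
    -- entail `e` below.
    have hP' := (hPi PEmpty ∅ (renameVars Sum.inl P) Set.finite_empty (finite_renameVars _ hP)).2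
      fun _ _ f hf => ((satisfies_union _ _ _).1 hf).1
    refine ⟨(satisfies_embedding_comp j a P).1 ?_, fun e he hQe => hbN e he ?_⟩
    · have := hP' B hB (Sum.elim b (Sum.elim (j ∘ a) PEmpty.elim)) ?_
      · rw [satisfies_renameVars, satisfies_renameVars] at this
        exact this
      · rw [satisfies_union]
        simp only [satisfies_renameVars, satisfies_empty, and_true]
        convert hbS using 1
        funext x
        rcases x with x | x <;> rfl
    · have hQ' := (hQi e PEmpty (renameVars Sum.inr (Q e)) (finite_renameVars _ (hQ e))).2
        fun _ _ f hf => hf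
      have := hQ' B hB (Sum.elim PEmpty.elim (Sum.elim (j ∘ a) b)) ?_
      · rw [satisfies_renameVars, satisfies_singleton] at this
        exact this
      · rw [satisfies_union]
        simp only [satisfies_renameVars]
        exact ⟨(satisfies_embedding_comp j a _).2 hQe, hbS⟩
  · rintro ⟨haP, haQ⟩
    let Dg : Set (Equation L (Y ⊕ A)) := positiveDiagram a
    let vS : Y ⊕ Z → Z ⊕ (Y ⊕ A) := Sum.elim (Sum.inr ∘ Sum.inl) Sum.inl
    -- The generators are the unknowns, the parameter variables and the elements of `A`; the diagram
    -- identifies each parameter variable with its value under `a`.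
    obtain ⟨B, hB, q, hq, hfin⟩ := hV.exists_presentation
      (renameVars vS S ∪ renameVars (Sum.inr : Y ⊕ A → Z ⊕ (Y ⊕ A)) Dg)
    rw [satisfies_union, satisfies_renameVars, satisfies_renameVars] at hq
    have hfin' : ∀ e : Equation L (Z ⊕ (Y ⊕ A)), e.1.realize q = e.2.realize q → ∃ D₀ ⊆ Dg,
        D₀.Finite ∧ Entails V (renameVars vS S ∪ renameVars Sum.inr D₀) {e} := by
      intro e he
      obtain ⟨S₀, hS₀, hf, hE⟩ := hfin e he
      obtain ⟨D₀, hD₀, hfD₀, hsub⟩ :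
          ∃ D₀ ⊆ Dg, D₀.Finite ∧ S₀ ⊆ renameVars vS S ∪ renameVars Sum.inr D₀ := by
        obtain ⟨D₀, hD₀, hfD, heq⟩ := Set.exists_subset_image_finite_and.1
          ⟨S₀ \ renameVars vS S, Set.sdiff_subset_iff.2 hS₀, hf.sdiff, rfl⟩
        exact ⟨D₀, hD₀, hfD, Set.sdiff_subset_iff.1 heq.subset⟩
      exact ⟨D₀, hD₀, hfD₀, fun C hC f hf => hE C hC f (hf.mono hsub)⟩
    have hmodel : ∀ D₀ ⊆ Dg, Satisfies (Sum.elim a id) D₀ := fun D₀ h e he => h he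
    obtain ⟨j, hj⟩ := exists_embedding_of_satisfies_positiveDiagram a (q ∘ Sum.inr) hq.2 (by
      intro x y hxy
      obtain ⟨D₀, hD₀, hf, hE⟩ := hfin' (Term.var (Sum.inr (Sum.inr x)),
        Term.var (Sum.inr (Sum.inr y))) hxy
      -- If `x` and `y` are identified, then `P` and `D₀` already entail `x = y`; both hold in `A`
      -- itself, so nothing in `A` collapses.
      have := (hPi A D₀ {(Term.var (Sum.inr x), Term.var (Sum.inr y))} hf
        (Set.finite_singleton _)).1 (by
          rw [renameVars_renameVars, renameVars_singleton]
          convert hE using 3 <;> first | rfl | (funext x; rcases x with x | x <;> rfl))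
      have := this A hA (Sum.elim a id) ?_
      · simpa [satisfies_singleton] using this
      · rw [satisfies_union, satisfies_renameVars]
        exact ⟨haP, hmodel _ hD₀⟩)
    have hqvS : q ∘ vS = Sum.elim (j ∘ a) (q ∘ Sum.inl) := by
      funext x
      rcases x with x | x
      · exact congrFun hj (Sum.inl x)
      · rfl
    refine ⟨B, hB, j, q ∘ Sum.inl, hqvS ▸ hq.1, fun e he hee => haQ e he ?_⟩
    rw [← hqvS] at hee
    obtain ⟨D₀, hD₀, hf, hE⟩ := hfin' (e.1.relabel vS, e.2.relabel vS)
      (by simpa only [Term.realize_relabel] using hee)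
    have hE' := hE.renameVars
      (Sum.elim (Sum.inr ∘ Sum.inr) (Sum.elim (Sum.inr ∘ Sum.inl) Sum.inl) :
        Z ⊕ (Y ⊕ A) → A ⊕ (Y ⊕ Z))
    -- If `e` is forced by `S` and `D₀`, then `D₀` alone entails `Q e`, which would thus hold at `a`
    -- in `A`.
    have := (hQi e A (renameVars Sum.swap D₀) (finite_renameVars _ hf)).1 (by
      rw [← renameVars_singleton] at hE'
      simp only [renameVars_union, renameVars_renameVars] at hE' ⊢
      rw [Set.union_comm]
      convert hE' using 3 <;> funext x <;> rcases x with x | x <;> rfl)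
    have := this A hA (Sum.elim id a) ?_
    · rw [satisfies_renameVars] at this
      exact this
    · rw [satisfies_renameVars]
      convert hmodel D₀ hD₀ using 1
      funext x
      rcases x with x | x <;> rfl

/-! ## Existentially closed algebras -/

/-- The criterion by `P` and `Q` sees only equations between parameters, which `j` preserves and
reflects. -/
theorem SolvableInExtension.mono [L.IsAlgebraic] {V : AlgebraClass L}
    (hV : IsVariety V) (hleft : LeftUniformMaehara V) (hright : RightUniformMaehara V)
    {Y Z : Type} [Finite Y] [Finite Z] {S N : Set (Equation L (Y ⊕ Z))} (hS : S.Finite)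
    {A B : CategoryTheory.Bundled.{max u v} L.Structure} (hA : A ∈ V) (hB : B ∈ V) (j : A ↪[L] B)
    {a : Y → A} (h : SolvableInExtension V S N A a) : SolvableInExtension V S N B (j ∘ a) := by
  obtain ⟨P, Q, -, -, hPQ⟩ := exists_solvableInExtension_iff hV hleft hright hS
  rw [hPQ A hA] at h
  rw [hPQ B hB]
  simpa only [satisfies_embedding_comp] using h

/-- A finite system in one unknown, with parameters in `A`, solvable in an extension of `A`. -/
structure SolvableSystem (V : AlgebraClass L)
    (A : CategoryTheory.Bundled.{max u v} L.Structure) where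
  n : ℕ
  pos : Set (Equation L (Fin n ⊕ Unit))
  neg : Set (Equation L (Fin n ⊕ Unit))
  params : Fin n → A
  finite_pos : pos.Finite
  solvable : SolvableInExtension V pos neg A params

/-- Finitely many systems solvable in extensions of `A` are solvable in a common extension. -/
theorem exists_extension_finset [L.IsAlgebraic] {V : AlgebraClass L}
    (hV : IsVariety V) (hleft : LeftUniformMaehara V) (hright : RightUniformMaehara V)
    {A : CategoryTheory.Bundled.{max u v} L.Structure} (hA : A ∈ V)
    (J : Finset (SolvableSystem V A)) :
    ∃ B ∈ V, ∃ j : A ↪[L] B, ∀ i ∈ J, ∃ b : Unit → B,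
      Solves (Sum.elim (j ∘ i.params) b) i.pos i.neg := by
  classical
  induction J using Finset.induction_on with
  | empty => exact ⟨A, hA, Embedding.refl L A, by simp⟩
  | insert i J _ ih =>
    obtain ⟨B, hB, j, hj⟩ := ih
    obtain ⟨C, hC, k, c, hc⟩ := i.solvable.mono hV hleft hright i.finite_pos hA hB j
    refine ⟨C, hC, k.comp j, fun i' hi' => ?_⟩
    rcases Finset.mem_insert.1 hi' with rfl | hi'
    · exact ⟨c, hc⟩
    · obtain ⟨b, hb⟩ := hj i' hi'
      refine ⟨k ∘ b, ?_⟩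
      rw [← solves_embedding_comp k, Sum.comp_elim] at hb
      exact hb

/-- All systems solvable in extensions of `A` are solvable in a common extension. -/
theorem exists_extension_solving [L.IsAlgebraic] [Nonempty L.Constants] {V : AlgebraClass L}
    (hV : IsVariety V) (hleft : LeftUniformMaehara V) (hright : RightUniformMaehara V)
    {A : CategoryTheory.Bundled.{max u v} L.Structure} (hA : A ∈ V) :
    ∃ B ∈ V, ∃ j : A ↪[L] B, ∀ i : SolvableSystem V A, ∃ b : Unit → B,
      Solves (Sum.elim (j ∘ i.params) b) i.pos i.neg := by
  classical
  let Dg : Set (Equation L (PEmpty.{1} ⊕ A)) := positiveDiagram PEmpty.elim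
  let X : Type (max u v) := SolvableSystem V A ⊕ A
  let vD : PEmpty.{1} ⊕ A → X := Sum.elim PEmpty.elim Sum.inr
  let vS : ∀ i : SolvableSystem V A, Fin i.n ⊕ Unit → X := fun i =>
    Sum.elim (Sum.inr ∘ i.params) fun _ => Sum.inl i
  obtain ⟨B, hB, q, hq, hfin⟩ := hV.exists_presentation
    (renameVars vD Dg ∪ ⋃ i, renameVars (vS i) i.pos)
  -- Compactness: an equation true in `B` uses finitely many systems, so it also holds in an
  -- extension of `A` solving these and those of `J₁`. Taking `J₁ = ∅` shows that `A` embeds; taking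
  -- `J₁ = {i}` shows that the negated equations of `i` are respected.
  have hmodel : ∀ (e : Equation L X) (J₁ : Finset (SolvableSystem V A)),
      e.1.realize q = e.2.realize q → ∃ C ∈ V, ∃ (k : A ↪[L] C) (c : SolvableSystem V A → C),
        e.1.realize (Sum.elim c k) = e.2.realize (Sum.elim c k) ∧
        ∀ i ∈ J₁, Solves (Sum.elim (k ∘ i.params) fun _ => c i) i.pos i.neg := by
    intro e J₁ he
    obtain ⟨S₀, hS₀, hf, hE⟩ := hfin e he
    obtain ⟨J, hJ⟩ : ∃ J : Finset (SolvableSystem V A),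
        S₀ ⊆ renameVars vD Dg ∪ ⋃ i ∈ J, renameVars (vS i) i.pos := by
      have h1 := Set.sdiff_subset_iff.2 hS₀
      obtain ⟨I, hI, hI'⟩ := Set.finite_subset_iUnion hf.sdiff h1
      refine ⟨hI.toFinset, Set.sdiff_subset_iff.1 ?_⟩
      simpa using hI'
    obtain ⟨C, hC, k, hk⟩ := exists_extension_finset hV hleft hright hA (J ∪ J₁)
    have : Nonempty C := ⟨funMap (Classical.arbitrary L.Constants) default⟩
    -- Systems outside `J ∪ J₁` may have no solution in `C`; their generators then get an arbitrary
    -- value.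
    let c : SolvableSystem V A → C := fun i => Classical.epsilon fun x =>
      Solves (Sum.elim (k ∘ i.params) fun _ => x) i.pos i.neg
    have hc : ∀ i ∈ J ∪ J₁, Solves (Sum.elim (k ∘ i.params) fun _ => c i) i.pos i.neg := by
      intro i hi
      obtain ⟨b, hb⟩ := hk i hi
      exact Classical.epsilon_spec
        (p := fun x => Solves (Sum.elim (k ∘ i.params) fun _ => x) i.pos i.neg) ⟨b (), hb⟩
    refine ⟨C, hC, k, c, (satisfies_singleton _ _).1 (hE C hC _ ?_), fun i hi =>
      hc i (Finset.mem_union_right _ hi)⟩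
    refine Satisfies.mono ?_ hJ
    rw [satisfies_union]
    refine ⟨?_, fun e he => ?_⟩
    · rw [satisfies_renameVars]
      have : Sum.elim c k ∘ vD = k ∘ Sum.elim PEmpty.elim id := by
        funext x
        rcases x with x | x
        · exact x.elim
        · rfl
      rw [this, satisfies_embedding_comp]
      exact fun e he => he
    · obtain ⟨i, hi, he⟩ := Set.mem_iUnion₂.1 he
      refine (satisfies_renameVars (vS i) (Sum.elim c k) i.pos).2 ?_ e he
      convert (hc i (Finset.mem_union_left _ hi)).1 using 1
      funext x
      rcases x with x | x <;> rfl
  rw [satisfies_union] at hq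
  obtain ⟨j, hj⟩ := exists_embedding_of_satisfies_positiveDiagram PEmpty.elim (q ∘ vD)
    ((satisfies_renameVars _ _ _).1 hq.1) (by
      intro x y hxy
      obtain ⟨C, hC, k, c, hk, -⟩ := hmodel (Term.var (Sum.inr x), Term.var (Sum.inr y)) ∅ hxy
      exact k.injective hk)
  have hjr : ∀ x, q (Sum.inr x) = j x := fun x => congrFun hj (Sum.inr x)
  have hjS : ∀ i, q ∘ vS i = Sum.elim (j ∘ i.params) fun _ => q (Sum.inl i) := by
    intro i
    funext x
    rcases x with x | x
    · exact hjr _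
    · rfl
  refine ⟨B, hB, j, fun i => ⟨fun _ => q (Sum.inl i), ?_, fun e he hee => ?_⟩⟩
  · rw [← hjS, ← satisfies_renameVars]
    exact hq.2.mono (Set.subset_iUnion (fun i => renameVars (vS i) i.pos) i)
  · rw [← hjS] at hee
    obtain ⟨C, hC, k, c, hk, hsol⟩ := hmodel (e.1.relabel (vS i), e.2.relabel (vS i)) {i}
      (by simpa only [Term.realize_relabel] using hee)
    refine (hsol i (Finset.mem_singleton_self i)).2 e he ?_
    simp only [Term.realize_relabel] at hk
    convert hk using 2 <;> funext x <;> rcases x with x | x <;> rfl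

/-- The members of `V` that solve every finite system in one unknown solvable in an extension
in `V`. -/
def existentiallyClosed (V : AlgebraClass L) : AlgebraClass L :=
  {A | A ∈ V ∧ ∀ i : SolvableSystem V A, ∃ b : Unit → A, Solves (Sum.elim i.params b) i.pos i.neg}

/-- Take the direct limit of an `ω`-chain built by `exists_extension_solving`: the parameters of a
system lie in some stage `n`, and stage `n + 1` solves it. -/
theorem IsVariety.exists_embedding_existentiallyClosed [L.IsAlgebraic] [Nonempty L.Constants]
    {V : AlgebraClass L}
    (hV : IsVariety V) (hleft : LeftUniformMaehara V) (hright : RightUniformMaehara V)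
    {A : CategoryTheory.Bundled.{max u v} L.Structure} (hA : A ∈ V) :
    ∃ B ∈ existentiallyClosed V, Nonempty (A ↪[L] B) := by
  choose F hF j hj using fun A : {A // A ∈ V} => exists_extension_solving hV hleft hright A.2
  let G : ℕ → {A // A ∈ V} := fun n => Nat.rec ⟨A, hA⟩ (fun _ A => ⟨F A, hF A⟩) n
  let G' : ℕ → Type (max u v) := fun n => (G n).1
  let f' : ∀ n, G' n ↪[L] G' (n + 1) := fun n => j (G n)
  let B : Type (max u v) := Language.DirectLimit G' (DirectedSystem.natLERec f')
  let ι : ∀ n, G' n ↪[L] B := fun n => Language.DirectLimit.of L ℕ G' (DirectedSystem.natLERec f') n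
  have hι : ∀ n x, ι (n + 1) (f' n x) = ι n x := by
    intro n x
    have := Language.DirectLimit.of_f (L := L) (G := G') (f := DirectedSystem.natLERec f')
      (hij := Nat.le_succ n) (x := x)
    rw [← this]
    congr 1
    simp [DirectedSystem.coe_natLERec, Nat.leRecOn_succ']
  have hex : ∀ {k : ℕ} (x : Fin k → B), ∃ (n : ℕ) (y : Fin k → G' n), x = ι n ∘ y := fun x =>
    Language.DirectLimit.exists_quotient_mk'_sigma_mk'_eq G' _ x
  refine ⟨⟨B, inferInstance⟩, ⟨?_, fun i => ?_⟩, ⟨ι 0⟩⟩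
  · obtain ⟨E, hE⟩ := hV
    refine (hE _).2 fun x e he => ?_
    -- Only finitely many variables occur in `e`, so their values come from a single stage, where
    -- the identity holds.
    obtain ⟨S, hS, hs⟩ := exists_finite_support (Set.finite_singleton e)
    obtain ⟨k, s, r, hsr⟩ := exists_fin_retraction hS
    have heq := hs (s ∘ r) hsr e rfl
    obtain ⟨n, y, hy⟩ := hex (x ∘ s)
    have := (hE _).1 (G n).2 (y ∘ r) e he
    rw [← realize_eq_embedding_comp (ι n), ← Function.comp_assoc, ← hy] at this
    rw [← heq]
    simp only [Term.realize_relabel]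
    exact this
  · obtain ⟨n, y, hy⟩ := hex i.params
    obtain ⟨C, hC, k, b, hb⟩ := i.solvable
    let i' : SolvableSystem V (G n).1 :=
      ⟨i.n, i.pos, i.neg, y, i.finite_pos, C, hC, k.comp (ι n), b, by
        convert hb using 1
        rw [hy]
        rfl⟩
    obtain ⟨c, hc⟩ := hj (G n) i'
    refine ⟨ι (n + 1) ∘ c, ?_⟩
    have hc' := (solves_embedding_comp (ι (n + 1)) _ _ _).2 hc
    have heq : Sum.elim i.params (ι (n + 1) ∘ c) =
        ι (n + 1) ∘ Sum.elim (f' n ∘ y) c := by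
      rw [Sum.comp_elim, hy]
      congr 1
      funext x
      exact (hι n (y x)).symm
    rw [heq]
    exact hc'

/-! ## Models of the theory of a class -/

/-- A formula valid in a class of non-empty algebras is valid in all models of its theory. -/
theorem realize_of_model_theoryOf {K : AlgebraClass L} (hne : ∀ A ∈ K, Nonempty A) {α : Type w}
    {φ : L.Formula α} (h : ∀ A ∈ K, ∀ f : α → A, φ.Realize f)
    {M : Type*} [L.Structure M] (hM : M ⊨ theoryOf K) (f : α → M) : φ.Realize f := by
  classical
  by_contra hf
  have hcl : M ⊨ φ.not.exClosure := by
    refine (Formula.realize_exClosure _).2 ⟨fun a => f a, ?_⟩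
    exact (BoundedFormula.realize_restrictFreeVar (φ := φ.not) (f := id)
      (v := fun a => f a) f (fun _ => rfl)).2 hf
  have hmem : φ.not.exClosure.not ∈ theoryOf K := by
    intro A hA
    rw [Sentence.realize_not]
    intro hcl
    obtain ⟨g, hg⟩ := (Formula.realize_exClosure _).1 hcl
    obtain ⟨x₀⟩ := hne A hA
    -- Variables not free in `φ` need some value, hence the non-emptiness.
    let g' : α → A := fun a =>
      if hmem : a ∈ φ.not.freeVarFinset then g ⟨a, hmem⟩ else x₀
    have := (BoundedFormula.realize_restrictFreeVar g'
      (fun a => by simp only [g', id, dif_pos a.2])).1 hg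
    exact this (h A hA g')
  exact (Sentence.realize_not M).1 (Theory.model_iff _ |>.1 hM _ hmem) hcl

theorem model_theoryOf {K : AlgebraClass L} {A : CategoryTheory.Bundled.{max u v} L.Structure}
    (hA : A ∈ K) : A ⊨ theoryOf K :=
  (Theory.model_iff _).2 fun _ hφ => hφ A hA

theorem nonempty_of_structure [Nonempty L.Constants] (A : Type*) [L.Structure A] : Nonempty A :=
  ⟨funMap (Classical.arbitrary L.Constants) default⟩

theorem IsVariety.mem_of_model_theoryOf [Nonempty L.Constants] {V : AlgebraClass L}
    (hV : IsVariety V) (A : CategoryTheory.Bundled.{max u v} L.Structure)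
    (hA : A ⊨ theoryOf V) : A ∈ V := by
  obtain ⟨E, hE⟩ := hV
  refine (hE A).2 fun f e he => ?_
  have := realize_of_model_theoryOf (fun A _ => nonempty_of_structure (L := L) A)
    (φ := e.1.equal e.2)
    (fun B hB g => by simpa only [Formula.realize_equal] using (hE B).1 hB g e he) hA f
  simpa only [Formula.realize_equal] using this

/-! ## Quantifier elimination over the existentially closed algebras -/

section QuantifierElimination

variable {α : Type w} {m : ℕ}

theorem exists_isQF_realize_iff_satisfies {S : Set (Equation L (α ⊕ Fin m))} (hS : S.Finite) :
    ∃ ψ : L.BoundedFormula α m, ψ.IsQF ∧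
      ∀ (A : CategoryTheory.Bundled.{max u v} L.Structure) (f : α → A) (xs : Fin m → A),
        ψ.Realize f xs ↔ Satisfies (Sum.elim f xs) S := by
  induction S, hS using Set.Finite.induction_on with
  | empty => exact ⟨⊤, BoundedFormula.IsQF.top, fun A f xs => by simp [satisfies_empty]⟩
  | @insert e S _ _ ih =>
    obtain ⟨ψ, hψ, h⟩ := ih
    refine ⟨e.1.bdEqual e.2 ⊓ ψ, (BoundedFormula.IsAtomic.equal _ _).isQF.inf hψ,
      fun A f xs => ?_⟩
    rw [BoundedFormula.realize_inf, h, BoundedFormula.realize_bdEqual, Set.insert_eq,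
      satisfies_union, satisfies_singleton]

theorem exists_isQF_realize_iff_forall_not_satisfies {ι : Type*} {N : Set ι} (hN : N.Finite)
    (Q : ι → Set (Equation L (α ⊕ Fin m))) (hQ : ∀ e, (Q e).Finite) :
    ∃ ψ : L.BoundedFormula α m, ψ.IsQF ∧
      ∀ (A : CategoryTheory.Bundled.{max u v} L.Structure) (f : α → A) (xs : Fin m → A),
        ψ.Realize f xs ↔ ∀ e ∈ N, ¬ Satisfies (Sum.elim f xs) (Q e) := by
  induction N, hN using Set.Finite.induction_on with
  | empty => exact ⟨⊤, BoundedFormula.IsQF.top, fun A f xs => by simp⟩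
  | @insert e N _ _ ih =>
    obtain ⟨ψ, hψ, h⟩ := ih
    obtain ⟨χ, hχ, h'⟩ := exists_isQF_realize_iff_satisfies (hQ e)
    refine ⟨χ.not ⊓ ψ, hχ.not.inf hψ, fun A f xs => ?_⟩
    rw [BoundedFormula.realize_inf, h, BoundedFormula.realize_not, h', Set.forall_mem_insert]

/-- The condition `p` on assignments is equivalent to a finite disjunction of finite systems of
equations and negated equations. -/
def IsDisjunctive {X : Type*}
    (p : ∀ A : CategoryTheory.Bundled.{max u v} L.Structure, (X → A) → Prop) : Prop :=
  ∃ l : List (Set (Equation L X) × Set (Equation L X)), (∀ c ∈ l, c.1.Finite ∧ c.2.Finite) ∧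
    ∀ A f, p A f ↔ ∃ c ∈ l, Solves f c.1 c.2

theorem IsDisjunctive.or {X : Type*}
    {p q : ∀ A : CategoryTheory.Bundled.{max u v} L.Structure, (X → A) → Prop}
    (hp : IsDisjunctive p) (hq : IsDisjunctive q) :
    IsDisjunctive fun A f => p A f ∨ q A f := by
  obtain ⟨l, hl, h⟩ := hp
  obtain ⟨l', hl', h'⟩ := hq
  refine ⟨l ++ l', fun c hc => ?_, fun A f => ?_⟩
  · exact (List.mem_append.1 hc).elim (hl c) (hl' c)
  · simp only [h, h', List.mem_append, or_and_right, exists_or]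

theorem IsDisjunctive.and {X : Type*}
    {p q : ∀ A : CategoryTheory.Bundled.{max u v} L.Structure, (X → A) → Prop}
    (hp : IsDisjunctive p) (hq : IsDisjunctive q) :
    IsDisjunctive fun A f => p A f ∧ q A f := by
  obtain ⟨l, hl, h⟩ := hp
  obtain ⟨l', hl', h'⟩ := hq
  refine ⟨(l ×ˢ l').map fun c => (c.1.1 ∪ c.2.1, c.1.2 ∪ c.2.2), fun c hc => ?_, fun A f => ?_⟩
  · obtain ⟨⟨c, c'⟩, hd, rfl⟩ := List.mem_map.1 hc
    obtain ⟨hc, hc'⟩ := List.mem_product.1 hd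
    exact ⟨(hl c hc).1.union (hl' c' hc').1, (hl c hc).2.union (hl' c' hc').2⟩
  · have key : ∀ c c' : Set (Equation L X) × Set (Equation L X),
        Solves f (c.1 ∪ c'.1) (c.2 ∪ c'.2) ↔ Solves f c.1 c.2 ∧ Solves f c'.1 c'.2 := by
      intro c c'
      simp only [Solves, satisfies_union, Set.mem_union, or_imp, forall_and]
      tauto
    simp only [h, h']
    constructor
    · rintro ⟨⟨c, hc, hs⟩, c', hc', hs'⟩
      exact ⟨_, List.mem_map.2 ⟨(c, c'), List.mem_product.2 ⟨hc, hc'⟩, rfl⟩,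
        (key c c').2 ⟨hs, hs'⟩⟩
    · rintro ⟨_, hd, hs⟩
      obtain ⟨⟨c, c'⟩, hc, rfl⟩ := List.mem_map.1 hd
      obtain ⟨hc, hc'⟩ := List.mem_product.1 hc
      obtain ⟨h1, h2⟩ := (key c c').1 hs
      exact ⟨⟨c, hc, h1⟩, c', hc', h2⟩

theorem IsDisjunctive.congr {X : Type*}
    {p q : ∀ A : CategoryTheory.Bundled.{max u v} L.Structure, (X → A) → Prop}
    (hp : IsDisjunctive p) (h : ∀ A f, q A f ↔ p A f) : IsDisjunctive q := by
  obtain ⟨l, hl, hl'⟩ := hp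
  exact ⟨l, hl, fun A f => (h A f).trans (hl' A f)⟩

/-- Both signs are proved together because implication negates its premise. -/
theorem isDisjunctive_realize [L.IsAlgebraic] {φ : L.BoundedFormula α m} (hφ : φ.IsQF) :
    IsDisjunctive (L := L) (fun A (f : α ⊕ Fin m → A) => φ.Realize (f ∘ Sum.inl) (f ∘ Sum.inr)) ∧
      IsDisjunctive (L := L) (fun A (f : α ⊕ Fin m → A) => ¬ φ.Realize (f ∘ Sum.inl) (f ∘ Sum.inr)) := by
  induction hφ with
  | falsum =>
    refine ⟨⟨[], by simp, fun A f => by simp [BoundedFormula.Realize]⟩,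
      ⟨[(∅, ∅)], by simp, fun A f => by simp [BoundedFormula.Realize, Solves, satisfies_empty]⟩⟩
  | of_isAtomic h =>
    cases h with
    | equal s t =>
      refine ⟨⟨[({(s, t)}, ∅)], by simp, fun A f => ?_⟩, ⟨[(∅, {(s, t)})], by simp, fun A f => ?_⟩⟩
      · simp [Solves, satisfies_singleton, Sum.elim_comp_inl_inr]
      · simp [Solves, satisfies_empty, Sum.elim_comp_inl_inr]
    | rel r => exact isEmptyElim r
  | imp _ _ ih ih' =>
    refine ⟨(ih.2.or ih'.1).congr fun A f => ?_, (ih.1.and ih'.2).congr fun A f => ?_⟩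
    · rw [BoundedFormula.realize_imp, imp_iff_not_or]
    · rw [BoundedFormula.realize_imp, Classical.not_imp]

theorem solves_renameVars {X Y A : Type*} [L.Structure A] (g : X → Y) (f : Y → A)
    (S N : Set (Equation L X)) :
    Solves f (renameVars g S) (renameVars g N) ↔ Solves (f ∘ g) S N := by
  refine and_congr (satisfies_renameVars g f S) ?_
  simp only [renameVars, Set.forall_mem_image, Term.realize_relabel, ne_eq]

variable [L.IsAlgebraic] {V : AlgebraClass L}
  (hV : IsVariety V) (hleft : LeftUniformMaehara V) (hright : RightUniformMaehara V)

include hV hleft hright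

/-- In an existentially closed algebra a system is solvable iff it is solvable in an extension, and
the latter is the quantifier-free condition given by `P` and `Q`. -/
theorem exists_isQF_realize_iff_exists_solves
    {S N : Set (Equation L (α ⊕ Fin (m + 1)))} (hS : S.Finite) (hN : N.Finite) :
    ∃ ψ : L.BoundedFormula α m, ψ.IsQF ∧ ∀ A ∈ existentiallyClosed V,
      ∀ (f : α → A) (xs : Fin m → A),
        ψ.Realize f xs ↔ ∃ x : A, Solves (Sum.elim f (Fin.snoc xs x : Fin (m + 1) → A)) S N := by
  -- The last bound variable becomes the unknown; `τ` then cuts the parameters down to the `k` that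
  -- matter.
  let σ : α ⊕ Fin (m + 1) → Unit ⊕ (α ⊕ Fin m) :=
    Sum.elim (Sum.inr ∘ Sum.inl) (Fin.snoc (fun i => Sum.inr (Sum.inr i)) (Sum.inl ()))
  obtain ⟨k, s, r, hsr⟩ := exists_fin_retraction_renameVars
    ((finite_renameVars σ hS).union (finite_renameVars σ hN))
  let τ : Unit ⊕ (α ⊕ Fin m) → Fin k ⊕ Unit := Sum.swap ∘ Sum.map id r
  let S' := renameVars τ (renameVars σ S)
  let N' := renameVars τ (renameVars σ N)
  have hS' : S'.Finite := finite_renameVars _ (finite_renameVars _ hS)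
  have hN' : N'.Finite := finite_renameVars _ (finite_renameVars _ hN)
  have hsolves : ∀ (A : CategoryTheory.Bundled.{max u v} L.Structure) (f : α → A)
      (xs : Fin m → A) (x : A), Solves (Sum.elim f (Fin.snoc xs x : Fin (m + 1) → A)) S N ↔
        Solves (Sum.elim (Sum.elim f xs ∘ s) fun _ => x) S' N' := by
    intro A f xs x
    have h1 : (Sum.elim f (Fin.snoc xs x : Fin (m + 1) → A)) =
        Sum.elim (fun _ => x) (Sum.elim f xs) ∘ σ := by
      funext y
      rcases y with y | y
      · rfl
      · refine Fin.lastCases ?_ (fun i => ?_) y <;> simp [σ]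
    rw [h1, ← solves_renameVars, ← hsr _ Set.subset_union_left, ← hsr _ Set.subset_union_right,
      solves_renameVars, solves_renameVars]
    have h2 : Sum.elim (fun _ => x) (Sum.elim f xs) ∘ Sum.map id (s ∘ r) =
        (Sum.elim (Sum.elim f xs ∘ s) fun _ => x) ∘ τ := by
      funext y
      rcases y with y | y <;> rfl
    rw [h2]
    simp only [S', N', solves_renameVars]
  obtain ⟨P, Q, hP, hQ, hPQ⟩ := exists_solvableInExtension_iff hV hleft hright hS'
  obtain ⟨ψ, hψ, hψP⟩ := exists_isQF_realize_iff_satisfies (finite_renameVars s hP)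
  obtain ⟨χ, hχ, hχQ⟩ := exists_isQF_realize_iff_forall_not_satisfies hN'
    (fun e => renameVars s (Q e)) fun e => finite_renameVars s (hQ e)
  refine ⟨ψ ⊓ χ, hψ.inf hχ, fun A hA f xs => ?_⟩
  rw [BoundedFormula.realize_inf, hψP, hχQ]
  simp only [hsolves, satisfies_renameVars]
  rw [← hPQ A hA.1 N']
  constructor
  · intro h
    obtain ⟨b, hb⟩ := hA.2 ⟨k, S', N', _, hS', h⟩
    exact ⟨b (), hb⟩
  · rintro ⟨x, hx⟩
    exact ⟨A, hA.1, Embedding.refl L A, fun _ => x, hx⟩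

/-- An existential quantifier distributes over a finite disjunction. -/
theorem exists_isQF_realize_iff_exists_list
    (l : List (Set (Equation L (α ⊕ Fin (m + 1))) × Set (Equation L (α ⊕ Fin (m + 1)))))
    (hl : ∀ c ∈ l, c.1.Finite ∧ c.2.Finite) :
    ∃ ψ : L.BoundedFormula α m, ψ.IsQF ∧ ∀ A ∈ existentiallyClosed V,
      ∀ (f : α → A) (xs : Fin m → A), ψ.Realize f xs ↔ ∃ x : A, ∃ c ∈ l,
        Solves (Sum.elim f (Fin.snoc xs x : Fin (m + 1) → A)) c.1 c.2 := by
  induction l with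
  | nil => exact ⟨⊥, BoundedFormula.isQF_bot, fun A _ f xs => by simp⟩
  | cons c l ih =>
    obtain ⟨ψ, hψ, h⟩ := ih fun c hc => hl c (List.mem_cons_of_mem _ hc)
    obtain ⟨hc, hc'⟩ := hl c List.mem_cons_self
    obtain ⟨χ, hχ, h'⟩ := exists_isQF_realize_iff_exists_solves hV hleft hright hc hc'
    refine ⟨χ ⊔ ψ, hχ.sup hψ, fun A hA f xs => ?_⟩
    rw [BoundedFormula.realize_sup, h A hA, h' A hA]
    simp only [List.mem_cons, or_and_right, exists_or, exists_eq_left]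

/-- Quantifier elimination over the existentially closed members of `V`. -/
theorem exists_isQF_realize_iff (φ : L.BoundedFormula α m) :
    ∃ ψ : L.BoundedFormula α m, ψ.IsQF ∧ ∀ A ∈ existentiallyClosed V,
      ∀ (f : α → A) (xs : Fin m → A), φ.Realize f xs ↔ ψ.Realize f xs := by
  induction φ with
  | falsum => exact ⟨_, BoundedFormula.IsQF.falsum, fun _ _ _ _ => Iff.rfl⟩
  | equal s t =>
    exact ⟨_, (BoundedFormula.IsAtomic.equal s t).isQF, fun _ _ _ _ => Iff.rfl⟩
  | rel r => exact isEmptyElim r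
  | imp _ _ ih ih' =>
    obtain ⟨ψ, hψ, h⟩ := ih
    obtain ⟨χ, hχ, h'⟩ := ih'
    refine ⟨ψ.imp χ, hψ.imp hχ, fun A hA f xs => ?_⟩
    rw [BoundedFormula.realize_imp, BoundedFormula.realize_imp, h A hA, h' A hA]
  | all _ ih =>
    obtain ⟨ψ, hψ, h⟩ := ih
    -- Read `∀` as `¬ ∃ ¬`, with `¬ ψ` in disjunctive form.
    obtain ⟨l, hl, hd⟩ := (isDisjunctive_realize hψ).2
    obtain ⟨χ, hχ, h'⟩ := exists_isQF_realize_iff_exists_list hV hleft hright l hl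
    refine ⟨χ.not, hχ.not, fun A hA f xs => ?_⟩
    rw [BoundedFormula.realize_all, BoundedFormula.realize_not, h' A hA]
    simp only [h A hA, ← hd]
    push Not
    rfl

end QuantifierElimination

/-! ## The model completion -/

/-- Truth of quantifier-free sentences with parameters from `M` is decided by the diagram. -/
theorem realize_equivSentence_iff_of_model_diagram [L.IsAlgebraic] {M : Type w} [L.Structure M]
    {N : Type*} [(L.withConstants M).Structure N] (hN : N ⊨ diagram L M) {φ : L.Formula M}
    (hφ : φ.IsQF) :
    N ⊨ Formula.equivSentence φ ↔ M ⊨ Formula.equivSentence φ := by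
  have hN' := (Theory.model_iff _).1 hN
  induction hφ with
  | falsum => exact Iff.rfl
  | of_isAtomic h =>
    cases h with
    | equal s t =>
      have hat : (Formula.equivSentence (s.bdEqual t : L.Formula M)).IsAtomic :=
        BoundedFormula.IsAtomic.equal _ _
      refine ⟨fun h => ?_, fun h => hN' _ ⟨Or.inl hat, h⟩⟩
      by_contra hM
      exact (Sentence.realize_not N).1
        (hN' _ ⟨Or.inr ⟨_, hat, rfl⟩, (Sentence.realize_not M).2 hM⟩) h
    | rel r => exact isEmptyElim r
  | @imp φ ψ _ _ ih ih' => exact imp_congr ih ih'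

theorem model_diagram_of_embedding {M N : Type*} [L.Structure M] [L.Structure N] (j : M ↪[L] N) :
    let _ := constantsOn.structure j
    N ⊨ diagram L M := by
  let _ := constantsOn.structure j
  refine (Theory.model_iff _).2 ?_
  let j' : M ↪[L.withConstants M] N :=
    { j.toEmbedding with
      map_fun' := fun {n} g x => by
        rcases g with g | g
        · exact j.map_fun g x
        · cases n with
          | zero => rfl
          | succ n => exact isEmptyElim g
      map_rel' := fun {n} g x => by
        rcases g with g | g
        · exact j.map_rel g x
        · exact isEmptyElim g }
  have key : ∀ φ : (L.withConstants M).Sentence, φ.IsAtomic → (N ⊨ φ ↔ M ⊨ φ) := fun φ hφ => by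
    rw [Sentence.Realize, Sentence.Realize, Formula.Realize, Formula.Realize,
      ← hφ.isQF.realize_embedding j']
    exact iff_of_eq (congrArg₂ _ (Subsingleton.elim _ _) (Subsingleton.elim _ _))
  rintro φ ⟨hφ | ⟨ψ, hψ, rfl⟩, h⟩
  · exact (key φ hφ).2 h
  · rw [Sentence.realize_not] at h ⊢
    rwa [key ψ hψ]

section ModelCompletion

variable [L.IsAlgebraic] [Nonempty L.Constants] {V : AlgebraClass L}
  (hV : IsVariety V) (hleft : LeftUniformMaehara V) (hright : RightUniformMaehara V)

include hV hleft hright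

/-- Quantifier elimination in the theory of the existentially closed members of `V`. -/
theorem exists_isQF_formula_realize_iff {α : Type w} (φ : L.Formula α) :
    ∃ ψ : L.Formula α, BoundedFormula.IsQF ψ ∧ ∀ (M : Type max u v) [L.Structure M],
      M ⊨ theoryOf (existentiallyClosed V) → ∀ f : α → M, φ.Realize f ↔ ψ.Realize f := by
  obtain ⟨ψ, hψ, h⟩ := exists_isQF_realize_iff hV hleft hright φ
  refine ⟨ψ, hψ, fun M _ hM f => ?_⟩
  have := realize_of_model_theoryOf (fun A _ => nonempty_of_structure (L := L) A)
    (φ := φ.iff ψ) (fun A hA g => Formula.realize_iff.2 (h A hA g _)) hM f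
  exact Formula.realize_iff.1 this

theorem isModelComplete_theoryOf_existentiallyClosed :
    IsModelComplete (theoryOf (existentiallyClosed V)) := by
  intro n φ
  obtain ⟨ψ, hψ, h⟩ := exists_isQF_formula_realize_iff hV hleft hright φ
  refine ⟨ψ, hψ.isExistential, fun M f xs => ?_⟩
  rw [Subsingleton.elim xs default]
  exact Formula.realize_iff.2 (h M M.is_model f)

/-- Existentially closed algebras belong to `V`; conversely, universal sentences descend from an
existentially closed extension. -/
theorem areCotheories_theoryOf_existentiallyClosed :
    AreCotheories (theoryOf V) (theoryOf (existentiallyClosed V)) := by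
  intro φ hφ
  rw [Theory.models_sentence_iff, Theory.models_sentence_iff]
  refine ⟨fun h M => ?_, fun h M => ?_⟩
  · have : M ⊨ theoryOf V :=
      (Theory.model_iff _).2 fun χ hχ => (Theory.model_iff _).1 M.is_model χ fun A hA => hχ A hA.1
    exact h ⟨M⟩
  · have hM : (⟨M, M.struc⟩ : CategoryTheory.Bundled L.Structure) ∈ V :=
      hV.mem_of_model_theoryOf _ M.is_model
    obtain ⟨B, hB, ⟨j⟩⟩ := hV.exists_embedding_existentiallyClosed hleft hright hM
    have := model_theoryOf hB
    have := nonempty_of_structure (L := L) B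
    have hBφ : B ⊨ φ := h ⟨B⟩
    refine hφ.realize_embedding j ?_
    rwa [Subsingleton.elim (j ∘ default : Empty → B) default,
      Subsingleton.elim (j ∘ default : Fin 0 → B) default]

/-- An existentially closed extension of `M` is a model. Completeness comes from reading a sentence
with parameters as an `L`-formula with variables in `M`: its quantifier-free equivalent is decided
by the diagram. -/
theorem isComplete_theoryOf_existentiallyClosed_union_diagram
    (M : FirstOrder.Language.Theory.ModelType.{u, v, max u v} (theoryOf V)) :
    ((L.lhomWithConstants M).onTheory (theoryOf (existentiallyClosed V)) ∪
      diagram L M).IsComplete := by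
  refine ⟨?_, fun σ => ?_⟩
  · have hM : (⟨M, M.struc⟩ : CategoryTheory.Bundled L.Structure) ∈ V :=
      hV.mem_of_model_theoryOf _ M.is_model
    obtain ⟨B, hB, ⟨j⟩⟩ := hV.exists_embedding_existentiallyClosed hleft hright hM
    have hBT := model_theoryOf hB
    have := nonempty_of_structure (L := L) B
    let _ := constantsOn.structure (M := B) j
    have h1 : B ⊨ (L.lhomWithConstants M).onTheory (theoryOf (existentiallyClosed V)) :=
      (LHom.onTheory_model _ _).2 hBT
    have h2 : B ⊨ diagram L M := model_diagram_of_embedding (M := M) j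
    have := Theory.model_union_iff.2 ⟨h1, h2⟩
    exact Theory.Model.isSatisfiable B
  · obtain ⟨ψ, hψ, h⟩ := exists_isQF_formula_realize_iff hV hleft hright
      (Formula.equivSentence.symm σ)
    have key : ∀ N : Theory.ModelType.{max u v, v, max u v}
        ((L.lhomWithConstants M).onTheory (theoryOf (existentiallyClosed V)) ∪ diagram L M),
        N ⊨ σ ↔ M ⊨ Formula.equivSentence ψ := by
      intro N
      obtain ⟨h1, h2⟩ := Theory.model_union_iff.1 N.is_model
      let _ : L.Structure N := (L.lhomWithConstants M).reduct N
      have : (L.lhomWithConstants M).IsExpansionOn N := LHom.isExpansionOn_reduct _ _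
      have hN := (LHom.onTheory_model _ _).1 h1
      exact (Formula.realize_equivSentence_symm_con N σ).symm.trans ((h N hN _).trans
        ((Formula.realize_equivSentence N ψ).symm.trans
          (realize_equivSentence_iff_of_model_diagram h2 hψ)))
    rw [Theory.models_sentence_iff, Theory.models_sentence_iff]
    by_cases hM : M ⊨ Formula.equivSentence ψ
    · exact Or.inl fun N => (key N).2 hM
    · exact Or.inr fun N => (Sentence.realize_not N).2 fun hN => hM ((key N).1 hN)

end ModelCompletion

end VarietyTheory

theorem corollary5p5 {L : FirstOrder.Language.{u, v}} [L.IsAlgebraic] [Nonempty L.Constants]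
    (V : VarietyTheory.AlgebraClass L) (hV : VarietyTheory.IsVariety V)
    (hleft : VarietyTheory.LeftUniformMaehara V)
    (hright : VarietyTheory.RightUniformMaehara V) :
    ∃ Tstar : L.Theory,
      VarietyTheory.IsModelCompletion (VarietyTheory.theoryOf V) Tstar :=
  ⟨VarietyTheory.theoryOf (VarietyTheory.existentiallyClosed V),
    ⟨VarietyTheory.isModelComplete_theoryOf_existentiallyClosed hV hleft hright,
      VarietyTheory.areCotheories_theoryOf_existentiallyClosed hV hleft hright⟩,
    VarietyTheory.isComplete_theoryOf_existentiallyClosed_union_diagram hV hleft hright⟩
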